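/- Let $1<t_0<N_0$ be integers and $\alpha=\log t_0/\log N_0$. For $n_0\in\mathbb N$ put $N=N_0^{2n_0}$, $t=t_0^{2n_0}$ and $[N]=\{0,1,\dots,N-1\}$. Given $A_0=\{0\}$ and, for each $j\ge 0$ and each $a\in A_j$, a set $A_{j+1,a}\subset N^{-(j+1)}[N]$ with $|A_{j+1,a}|=t$, where $$A_{j+1}=\bigcup_{a\in A_j}(a+A_{j+1,a}),$$ let $E_j=\bigcup_{a\in A_j}(a+[0,N^{-j}])$, $E=\bigcap_{j\ge1}E_j$, and let $\mu_j$ be the measure on $\mathbb R$ with density $\sum_{a\in A_j}t^{-j}N^j\mathbf 1_{[a,a+N^{-j}]}$. Given an arithmetic progression $P\subset[N]$ with $t^{1/2}=t_0^{n_0}$ distinct terms, let $P_0=\{0\}$, $P_{j+1}=\bigcup_{a\in P_j}(a+N^{-(j+1)}P)$, $F_j=\bigcup_{a\in P_j}(a+[0,N^{-j}))$ and $f_\ell=\mathbf 1_{F_\ell}$. For a finite measure $\nu$ on $\mathbb R$ write $\widehat\nu(k)=\int e^{-2\pi i kx}\,d\nu(x)$. **Proposition.** For every $n_0$ that is sufficiently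 large (depending on $N_0,t_0$) there are constants $C(\beta,n_0)$ and $C(\beta,\ell,n_0)$ (which may also depend on the fixed $N_0,t_0$, but on nothing else) such that, for every arithmetic progression $P\subset[N]$ of length $t^{1/2}$, the sets $A_{j+1,a}$ can be chosen, as above, so that $P_j\subset A_j$ and $F_j\subset E_j$ for all $j\ge0$, the measures $\mu_j$ converge weakly to a probability measure $\mu$ carried by $E$ (that is, $\mu(\mathbb R\setminus E)=0$), and for every $0<\beta<\alpha$ $$|\widehat{\mu}(k)|\le C(\beta,n_0)\,|k|^{-\beta/2}\qquad(k\in\mathbb Z\setminus\{0\}),$$ $$|\widehat{f_\ell\mu_j}(k)|\le C(\beta,\ell,n_0)\,|k|^{-\beta/2}\qquad(k\in\mathbb Z\setminus\{0\},\ \ell\ge 0,\ j\ge\ell).$$ -/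

import Mathlib

open MeasureTheory Filter Topology

noncomputable section

namespace SalemCantor

/-- The grid `N^{-j} [N] = {0, N^{-j}, …, (N - 1) N^{-j}}`, where `[N] = {0, 1, …, N - 1}`. -/
def grid (N j : ℕ) : Finset ℝ :=
  (Finset.range N).image fun m : ℕ => (m : ℝ) / (N : ℝ) ^ j

/-- The sets `A_j` of left endpoints of a Cantor iteration, built from a choice `D` of digit sets,
where `D (j + 1) a` is the set `A_{j+1,a}`:
`A_0 = {0}` and `A_{j+1} = ⋃_{a ∈ A_j} (a + A_{j+1,a})`. -/
def endpoints (D : ℕ → ℝ → Finset ℝ) : ℕ → Finset ℝ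
  | 0 => {0}
  | j + 1 => (endpoints D j).biUnion fun a => (D (j + 1) a).image fun b => a + b

/-- The requirement on the choice of the sets `A_{j+1,a}`, `a ∈ A_j`: they are subsets of
`N^{-(j+1)} [N]` with exactly `t` elements. -/
def IsAdmissible (N t : ℕ) (D : ℕ → ℝ → Finset ℝ) : Prop :=
  ∀ j : ℕ, ∀ a ∈ endpoints D j, D (j + 1) a ⊆ grid N (j + 1) ∧ (D (j + 1) a).card = t

/-- The sets `E_j = ⋃_{a ∈ A_j} a + [0, N^{-j}]`. -/
def level (N : ℕ) (D : ℕ → ℝ → Finset ℝ) (j : ℕ) : Set ℝ :=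
  ⋃ a ∈ endpoints D j, Set.Icc a (a + 1 / (N : ℝ) ^ j)

/-- The Cantor set `E = ⋂_{j ≥ 1} E_j`. -/
def cantorSet (N : ℕ) (D : ℕ → ℝ → Finset ℝ) : Set ℝ :=
  ⋂ j ≥ 1, level N D j

/-- The density `∑_{a ∈ A_j} t^{-j} N^j 1_{[a, a + N^{-j}]}`. -/
def density (N t : ℕ) (D : ℕ → ℝ → Finset ℝ) (j : ℕ) (x : ℝ) : ℝ :=
  ∑ a ∈ endpoints D j, ((t : ℝ) ^ j)⁻¹ * (N : ℝ) ^ j *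
    (Set.Icc a (a + 1 / (N : ℝ) ^ j)).indicator (fun _ => (1 : ℝ)) x

/-- The absolutely continuous measure `μ_j` with the above density. -/
def levelMeasure (N t : ℕ) (D : ℕ → ℝ → Finset ℝ) (j : ℕ) : Measure ℝ :=
  volume.withDensity fun x => ENNReal.ofReal (density N t D j x)

/-- `μ` is a weak limit of the measures `ν j`: integrals of bounded continuous functions
converge. -/
def IsWeakLimit (ν : ℕ → Measure ℝ) (μ : Measure ℝ) : Prop :=
  ∀ g : BoundedContinuousFunction ℝ ℝ,
    Tendsto (fun j => ∫ x, g x ∂(ν j)) atTop (𝓝 (∫ x, g x ∂μ))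

/-- `P` is an arithmetic progression with exactly `L` (distinct) terms. -/
def IsArithProg (P : Finset ℕ) (L : ℕ) : Prop :=
  ∃ x d : ℕ, 0 < d ∧ P = (Finset.range L).image fun i => x + i * d

/-- The structured sets: `P_0 = {0}` and `P_{j+1} = ⋃_{a ∈ P_j} (a + N^{-(j+1)} P)`. -/
def structured (N : ℕ) (P : Finset ℕ) : ℕ → Finset ℝ
  | 0 => {0}
  | j + 1 => (structured N P j).biUnion fun a =>
      P.image fun p : ℕ => a + (p : ℝ) / (N : ℝ) ^ (j + 1)

/-- The sets `F_j = ⋃_{a ∈ P_j} a + [0, N^{-j})`. -/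
def structuredLevel (N : ℕ) (P : Finset ℕ) (j : ℕ) : Set ℝ :=
  ⋃ a ∈ structured N P j, Set.Ico a (a + 1 / (N : ℝ) ^ j)

/-- The characteristic function `f_ℓ` of `F_ℓ`. -/
def charFn (N : ℕ) (P : Finset ℕ) (l : ℕ) : ℝ → ℝ :=
  (structuredLevel N P l).indicator fun _ => 1

/-- The Fourier transform `∫ e^{-2πi ξ x} dμ(x)` of a measure `μ` on `ℝ`. -/
def fourierMeasure (μ : Measure ℝ) (ξ : ℝ) : ℂ :=
  ∫ x, Complex.exp (-2 * Real.pi * Complex.I * ξ * x) ∂μ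

/-- The Fourier transform `∫ f(x) e^{-2πi ξ x} dμ(x)` of the measure `f dμ`. -/
def fourierWeighted (f : ℝ → ℝ) (μ : Measure ℝ) (ξ : ℝ) : ℂ :=
  ∫ x, (f x : ℂ) * Complex.exp (-2 * Real.pi * Complex.I * ξ * x) ∂μ

end SalemCantor

end

/-! The digits are chosen level by level. A node of the structured tree receives a fixed `t`-set
containing `P`; every other node receives a random cyclic translate of `{0, …, t - 1}` modulo `N`,
whose discrepancy against the uniform digits has mean zero. With `L = t^{1/2}`, the `t^j = L^{2j}`
nodes of level `j` produce a random sum of size about `L^j`, up to a factor linear in `j`, while the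
`L^j` structured nodes contribute `O(L^j)` trivially. So progressions of length `t^{1/2}` are lost
in the noise (`exists_digits`, `exists_digitTree`). Integer frequencies matter only modulo `N^{j+1}`
and there are `j + 1` restrictions `l ≤ j`, so a union bound costs only a logarithm, linear in `j`.

Passing from level `j` to `j + 1` changes the Fourier transform by exactly `t^{-j}` times the
transform of a small cell times that discrepancy sum (`treeTransform_sub`). The cell factor is at
most `N^{γ(j+1)} |k|^{-γ}`, so the increments are `O((j + 1) (N^γ / L)^j |k|^{-γ})`. For `γ = β/2`
the ratio is below `1` exactly when `β < α`, and the series converges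
(`norm_treeTransform_filter_le`). Multiplying by `f_ℓ` merely restricts the sums to nodes whose
ancestor at level `ℓ` is structured. -/

namespace SalemCantor

open Finset

/-! ### Simultaneous choices by exponential moments -/

/-- Derandomised Hoeffding inequality: the exponential moments of finitely many sums of independent
centred choices can be bounded simultaneously. -/
theorem exists_choice_sum_exp_le {ι Ω τ : Type*} [DecidableEq ι] (s : Finset ι) (O : Finset Ω)
    (hO : O.Nonempty) (T : Finset τ) (v : τ → ι → Ω → ℝ) (hv : ∀ r i x, |v r i x| ≤ 1)
    (hmean : ∀ r i, ∑ x ∈ O, v r i x = 0) (c : ℝ) :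
    ∃ x : ι → Ω, (∀ i, x i ∈ O) ∧
      ∑ r ∈ T, Real.exp (c * ∑ i ∈ s, v r i (x i)) ≤ #T * Real.exp (#s * (c ^ 2 / 2)) := by
  induction s using Finset.induction_on with
  | empty =>
    obtain ⟨y, hy⟩ := hO
    exact ⟨fun _ => y, fun _ => hy, by simp⟩
  | insert i₀ s hi ih =>
    obtain ⟨x, hx, hsum⟩ := ih
    set w : τ → ℝ := fun r => Real.exp (c * ∑ i ∈ s, v r i (x i)) with hw
    -- Convexity bounds the exponential by its chord on `[-1, 1]`; the zero mean kills the `sinh`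
    -- term.
    have key : ∀ r, ∑ y ∈ O, Real.exp (c * v r i₀ y) ≤ #O * Real.exp (c ^ 2 / 2) := by
      intro r
      calc ∑ y ∈ O, Real.exp (c * v r i₀ y)
          ≤ ∑ y ∈ O, (Real.cosh c + v r i₀ y * Real.sinh c) := by
            refine sum_le_sum fun y _ => ?_
            rw [mul_comm]
            exact Real.exp_mul_le_cosh_add_mul_sinh (hv r i₀ y) c
        _ = #O * Real.cosh c := by
            rw [sum_add_distrib, ← sum_mul, hmean]; simp
        _ ≤ _ := by gcongr; exact Real.cosh_le_exp_half_sq c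
    -- Method of conditional expectations: some value at `i₀` does no worse than the average.
    have avg : ∑ y ∈ O, ∑ r ∈ T, w r * Real.exp (c * v r i₀ y) ≤
        ∑ _y ∈ O, Real.exp (c ^ 2 / 2) * ∑ r ∈ T, w r := by
      rw [sum_comm, sum_const, nsmul_eq_mul, mul_sum, mul_sum]
      refine sum_le_sum fun r _ => ?_
      rw [← mul_sum]
      have := mul_le_mul_of_nonneg_left (key r) (Real.exp_pos _ : 0 < w r).le
      linarith
    obtain ⟨y, hy, hle⟩ := exists_le_of_sum_le hO avg
    refine ⟨Function.update x i₀ y, fun i => ?_, ?_⟩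
    · by_cases h : i = i₀
      · subst h; simpa using hy
      · simpa [h] using hx i
    · have e : ∀ r, Real.exp (c * ∑ i ∈ insert i₀ s, v r i (Function.update x i₀ y i)) =
          w r * Real.exp (c * v r i₀ y) := by
        intro r
        have h' : ∑ i ∈ s, v r i (Function.update x i₀ y i) = ∑ i ∈ s, v r i (x i) := by
          refine sum_congr rfl fun i his => ?_
          rw [Function.update_of_ne (by rintro rfl; exact hi his)]
        rw [sum_insert hi, h', hw, ← Real.exp_add]
        rw [Function.update_self, mul_add, add_comm]
      simp_rw [e]
      calc _ ≤ Real.exp (c ^ 2 / 2) * ∑ r ∈ T, w r := hle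
        _ ≤ Real.exp (c ^ 2 / 2) * (#T * Real.exp (#s * (c ^ 2 / 2))) := by gcongr
        _ = _ := by
          rw [card_insert_of_notMem hi]; push_cast
          rw [add_mul, one_mul, Real.exp_add]; ring

/-- A complex sum is controlled by its real parts in the four directions `±1, ±I`, hence the factor
`4` inside the logarithm; adding real and imaginary parts costs the outer `2`. The parameter `c`
stays free, to be balanced against the number of summands. -/
theorem exists_choice_norm_sum_le {ι Ω τ : Type*} [DecidableEq ι] (s : Finset ι) (O : Finset Ω)
    (hO : O.Nonempty) (T : Finset τ) (u : τ → ι → Ω → ℂ) (hu : ∀ r i x, ‖u r i x‖ ≤ 1)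
    (hmean : ∀ r i, ∑ x ∈ O, u r i x = 0) {c : ℝ} (hc : 0 < c) :
    ∃ x : ι → Ω, (∀ i, x i ∈ O) ∧ ∀ r ∈ T,
      ‖∑ i ∈ s, u r i (x i)‖ ≤ 2 * (Real.log (4 * #T) / c + #s * c / 2) := by
  classical
  set Z : Finset ℂ := {1, -1, Complex.I, -Complex.I} with hZ
  have hZn : ∀ z : Z, ‖(z : ℂ)‖ ≤ 1 := by
    rintro ⟨z, hz⟩
    simp only [hZ, mem_insert, mem_singleton] at hz
    rcases hz with rfl | rfl | rfl | rfl <;> simp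
  have hZc : (#(T ×ˢ (univ : Finset Z)) : ℝ) ≤ 4 * #T := by
    have : #Z ≤ 4 := card_le_four
    rw [card_product, card_univ, Fintype.card_coe]
    push_cast
    have : (#Z : ℝ) ≤ 4 := by exact_mod_cast this
    nlinarith [(Nat.cast_nonneg #T : (0 : ℝ) ≤ #T)]
  obtain ⟨x, hx, hsum⟩ := exists_choice_sum_exp_le s O hO (T ×ˢ (univ : Finset Z))
    (fun r i x => ((r.2 : ℂ) * u r.1 i x).re)
    (fun r i x => (Complex.abs_re_le_norm _).trans (by
      rw [norm_mul]; exact mul_le_one₀ (hZn _) (norm_nonneg _) (hu _ _ _)))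
    (fun r i => by rw [← Complex.re_sum, ← mul_sum, hmean]; simp) c
  refine ⟨x, hx, fun r hr => ?_⟩
  have dir : ∀ z : Z, ((z : ℂ) * ∑ i ∈ s, u r i (x i)).re ≤
      Real.log (4 * #T) / c + #s * c / 2 := by
    intro z
    have hT : (0 : ℝ) < #T := by exact_mod_cast card_pos.2 ⟨r, hr⟩
    have h1 := single_le_sum (f := fun r : τ × Z =>
      Real.exp (c * ∑ i ∈ s, ((r.2 : ℂ) * u r.1 i (x i)).re))
      (fun _ _ => (Real.exp_pos _).le) (mk_mem_product hr (mem_univ z))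
    have h2 : Real.exp (c * ((z : ℂ) * ∑ i ∈ s, u r i (x i)).re) ≤
        (4 * #T) * Real.exp (#s * (c ^ 2 / 2)) := by
      refine le_trans ?_ (h1.trans (hsum.trans (by gcongr)))
      simp only [mul_sum, Complex.re_sum, le_refl]
    have h3 := Real.log_le_log (Real.exp_pos _) h2
    rw [Real.log_exp, Real.log_mul (by positivity) (Real.exp_pos _).ne', Real.log_exp] at h3
    rw [← mul_le_mul_iff_right₀ hc]
    refine h3.trans (le_of_eq ?_)
    field_simp
  set S := ∑ i ∈ s, u r i (x i)
  have d1 := dir ⟨1, by simp [hZ]⟩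
  have d2 := dir ⟨-1, by simp [hZ]⟩
  have d3 := dir ⟨Complex.I, by simp [hZ]⟩
  have d4 := dir ⟨-Complex.I, by simp [hZ]⟩
  simp at d1 d2 d3 d4
  refine (Complex.norm_le_abs_re_add_abs_im S).trans ?_
  have a1 := abs_le.2 ⟨by linarith, d1⟩
  have a2 := abs_le.2 ⟨by linarith, d4⟩
  linarith

/-! ### Discrepancy of digit sets and cyclic intervals -/

/-- The difference between the average of `f` over a digit set `B` with `t` elements and its average
over all digits `0, …, N - 1`. -/
noncomputable def discrepancy (N t : ℕ) (f : ℕ → ℂ) (B : Finset ℕ) : ℂ :=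
  (t : ℂ)⁻¹ * ∑ b ∈ B, f b - (N : ℂ)⁻¹ * ∑ b ∈ range N, f b

theorem norm_average_sub_le {n : ℕ} (hn : 0 < n) {f : ℕ → ℂ} {B : Finset ℕ} (hB : #B = n) {z : ℂ}
    {ε : ℝ} (hf : ∀ b ∈ B, ‖f b - z‖ ≤ ε) : ‖(n : ℂ)⁻¹ * ∑ b ∈ B, f b - z‖ ≤ ε := by
  have hn' : (n : ℂ) ≠ 0 := by exact_mod_cast hn.ne'
  have : (n : ℂ)⁻¹ * ∑ b ∈ B, f b - z = (n : ℂ)⁻¹ * ∑ b ∈ B, (f b - z) := by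
    rw [sum_sub_distrib, sum_const, hB, nsmul_eq_mul]; field_simp
  rw [this, norm_mul, norm_inv, Complex.norm_natCast, inv_mul_le_iff₀ (by exact_mod_cast hn)]
  refine (norm_sum_le_of_le _ hf).trans ?_
  simp [hB]

theorem norm_discrepancy_le {N t : ℕ} (hN : 0 < N) (ht : 0 < t) {f : ℕ → ℂ} {B : Finset ℕ}
    (hB : B ⊆ range N) (hBt : #B = t) {z : ℂ} {ε : ℝ} (hf : ∀ b ∈ range N, ‖f b - z‖ ≤ ε) :
    ‖discrepancy N t f B‖ ≤ 2 * ε := by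
  have h1 := norm_average_sub_le ht hBt (fun b hb => hf b (hB hb))
  have h2 := norm_average_sub_le hN (card_range N) hf
  have : discrepancy N t f B = ((t : ℂ)⁻¹ * ∑ b ∈ B, f b - z) -
      ((N : ℂ)⁻¹ * ∑ b ∈ range N, f b - z) := by simp [discrepancy]
  rw [this]
  exact (norm_sub_le _ _).trans (by linarith)

theorem add_mod_injOn (N x : ℕ) : Set.InjOn (fun b => (b + x) % N) (range N : Set ℕ) := by
  intro b hb b' hb' h
  simp only [coe_range, Set.mem_Iio] at hb hb'
  exact Nat.ModEq.eq_of_lt_of_lt (Nat.ModEq.add_right_cancel' x h) hb hb'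

/-- The cyclic translates of `{0, …, t - 1}` modulo `N`. -/
def cyclicInterval (N t x : ℕ) : Finset ℕ := (range t).image fun b => (b + x) % N

theorem cyclicInterval_subset {N : ℕ} (hN : 0 < N) (t x : ℕ) : cyclicInterval N t x ⊆ range N := by
  intro b hb
  obtain ⟨a, -, rfl⟩ := mem_image.1 hb
  exact mem_range.2 (Nat.mod_lt _ hN)

theorem cyclicInterval_injOn {N t : ℕ} (h : t ≤ N) (x : ℕ) :
    Set.InjOn (fun b => (b + x) % N) (range t : Set ℕ) :=
  (add_mod_injOn N x).mono (by exact_mod_cast range_subset_range.2 h)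

theorem card_cyclicInterval {N t : ℕ} (h : t ≤ N) (x : ℕ) : #(cyclicInterval N t x) = t := by
  rw [cyclicInterval, card_image_of_injOn (cyclicInterval_injOn h x), card_range]

theorem sum_add_mod {N : ℕ} (hN : 0 < N) (f : ℕ → ℂ) (b : ℕ) :
    ∑ x ∈ range N, f ((b + x) % N) = ∑ x ∈ range N, f x := by
  have hinj := add_mod_injOn N b
  have : (range N).image (fun x => (x + b) % N) = range N :=
    eq_of_subset_of_card_le (cyclicInterval_subset hN N b)
      (by rw [card_image_of_injOn hinj])
  conv_rhs => rw [← this, sum_image hinj]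
  simp_rw [add_comm b]

/-- Each residue lies in exactly `t` of the `N` translates, so a uniformly random shift gives a set
of exact size `t` with unbiased averages. -/
theorem sum_discrepancy_cyclicInterval {N t : ℕ} (hN : 0 < N) (ht : 0 < t) (h : t ≤ N)
    (f : ℕ → ℂ) : ∑ x ∈ range N, discrepancy N t f (cyclicInterval N t x) = 0 := by
  have ht' : (t : ℂ) ≠ 0 := by exact_mod_cast ht.ne'
  have hN' : (N : ℂ) ≠ 0 := by exact_mod_cast hN.ne'
  simp_rw [discrepancy, sum_sub_distrib, ← mul_sum]
  simp_rw [cyclicInterval, sum_image (cyclicInterval_injOn h _)]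
  rw [sum_comm]
  simp_rw [sum_add_mod hN]
  simp only [sum_const, card_range, nsmul_eq_mul]
  field_simp
  simp

/-! ### Characters and the choice of digits at one level -/

/-- The character `x ↦ e^{-2πi ξ x}`. -/
noncomputable def wave (ξ x : ℝ) : ℂ := Complex.exp (-2 * Real.pi * Complex.I * ξ * x)

theorem wave_eq (ξ x : ℝ) : wave ξ x = Complex.exp ((-2 * Real.pi * ξ * x : ℝ) * Complex.I) := by
  rw [wave]; congr 1; push_cast; ring

@[simp] theorem norm_wave (ξ x : ℝ) : ‖wave ξ x‖ = 1 := by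
  rw [wave_eq, Complex.norm_exp_ofReal_mul_I]

theorem wave_add (ξ x y : ℝ) : wave ξ (x + y) = wave ξ x * wave ξ y := by
  rw [wave, wave, wave, ← Complex.exp_add]; congr 1; push_cast; ring

theorem norm_wave_sub_one_le (ξ x : ℝ) : ‖wave ξ x - 1‖ ≤ 2 * Real.pi * |ξ| * |x| := by
  have h := Real.norm_exp_I_mul_ofReal_sub_one_le (x := -2 * Real.pi * ξ * x)
  rw [wave_eq, mul_comm]
  refine h.trans (le_of_eq ?_)
  rw [Real.norm_eq_abs, abs_mul, abs_mul, abs_mul, abs_neg, abs_two, abs_of_pos Real.pi_pos]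

theorem continuous_wave (ξ : ℝ) : Continuous (wave ξ) := by
  unfold wave; fun_prop

/-- This periodicity reduces the conditions on all integer frequencies to finitely many. -/
theorem wave_int_emod {q : ℕ} (hq : 0 < q) (k : ℤ) (n : ℕ) :
    wave k (n / q) = wave ((k % (q : ℤ)).toNat : ℕ) (n / q) := by
  have h0 : (((k % (q : ℤ)).toNat : ℕ) : ℤ) = k % q :=
    Int.toNat_of_nonneg (Int.emod_nonneg _ (by exact_mod_cast hq.ne'))
  have h1 : (k : ℂ) = ((k % (q : ℤ)).toNat : ℕ) + q * (k / q : ℤ) := by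
    have : k = ((k % (q : ℤ)).toNat : ℕ) + q * (k / q) := by
      rw [h0]; exact (Int.emod_add_mul_ediv k q).symm
    exact_mod_cast congrArg (Int.cast : ℤ → ℂ) this
  have hq' : (q : ℂ) ≠ 0 := by exact_mod_cast hq.ne'
  rw [wave, wave, Complex.exp_eq_exp_iff_exists_int]
  refine ⟨-(k / q) * n, ?_⟩
  push_cast
  rw [h1]
  field_simp
  ring

theorem exists_digits {N t L : ℕ} (hN : 0 < N) (hL : 0 < L) (htL : L * L = t) (htN : t ≤ N)
    {P : Finset ℕ} (hP : P ⊆ range N) (hPc : #P = L) (j : ℕ) (M Q : Finset ℕ) (hM : #M = t ^ j)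
    (hQ : #Q ≤ L ^ j) (G : ℕ → ℕ → Prop) [∀ l, DecidablePred (G l)] :
    ∃ B : ℕ → Finset ℕ, (∀ m, B m ⊆ range N ∧ #(B m) = t) ∧ (∀ m ∈ Q, P ⊆ B m) ∧
      ∀ l ≤ j, ∀ k : ℤ,
        ‖∑ m ∈ M with G l m, discrepancy N t
            (fun b => wave k (((N * m + b : ℕ) : ℝ) / (N ^ (j + 1) : ℕ))) (B m)‖ ≤
          (16 + 4 * Real.log N) * (j + 1) * L ^ j := by
  have ht : 0 < t := htL ▸ Nat.mul_pos hL hL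
  have hPt : #P ≤ t := by rw [hPc, ← htL]; exact Nat.le_mul_of_pos_left L hL
  obtain ⟨B₀, hPB, hBN, hBc⟩ := exists_subsuperset_card_eq hP hPt (by simpa using htN)
  have hq : 0 < N ^ (j + 1) := pow_pos hN _
  let g : ℕ → ℕ → ℕ → ℂ := fun k m b => wave k (((N * m + b : ℕ) : ℝ) / (N ^ (j + 1) : ℕ))
  -- The factor `1/2` normalises a discrepancy of size at most `2`. Encoding the restriction `G` in
  -- the summand lets one choice of shifts serve every `l` and `k`.
  let u : ℕ × ℕ → ℕ → ℕ → ℂ := fun r m x =>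
    if G r.1 m then 2⁻¹ * discrepancy N t (g r.2 m) (cyclicInterval N t x) else 0
  have triv : ∀ k m (B : Finset ℕ), B ⊆ range N → #B = t → ‖discrepancy N t (g k m) B‖ ≤ 2 := by
    intro k m B hB hBt
    simpa using norm_discrepancy_le hN ht hB hBt (z := 0) (ε := 1) (fun b _ => by simp [g])
  have hu : ∀ r m x, ‖u r m x‖ ≤ 1 := by
    intro r m x
    simp only [u]
    split_ifs
    · rw [norm_mul]
      have := triv r.2 m _ (cyclicInterval_subset hN t x) (card_cyclicInterval htN x)
      norm_num
      linarith
    · simp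
  have hmean : ∀ r m, ∑ x ∈ range N, u r m x = 0 := by
    intro r m
    simp only [u]
    split_ifs
    · rw [← mul_sum, sum_discrepancy_cyclicInterval hN ht htN, mul_zero]
    · simp
  have hL' : (0 : ℝ) < (L : ℝ) ^ j := by positivity
  -- With up to `L^{2j}` summands, `c = L^{-j}` makes both terms of the bound of order `L^j`, up to
  -- the logarithm.
  obtain ⟨x, hx, hbound⟩ := exists_choice_norm_sum_le (M \ Q) (range N) (by simpa using hN.ne')
    (range (j + 1) ×ˢ range (N ^ (j + 1))) u hu hmean (inv_pos.2 hL')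
  refine ⟨fun m => if m ∈ Q then B₀ else cyclicInterval N t (x m), fun m => ?_, fun m hm => ?_,
    fun l hl k => ?_⟩
  · dsimp only
    split_ifs
    · exact ⟨hBN, hBc⟩
    · exact ⟨cyclicInterval_subset hN _ _, card_cyclicInterval htN _⟩
  · simpa [hm] using hPB
  · set k' := (k % ((N ^ (j + 1) : ℕ) : ℤ)).toNat with hk'
    have hk'lt : k' < N ^ (j + 1) := by
      have := Int.emod_lt_of_pos k (b := ((N ^ (j + 1) : ℕ) : ℤ)) (by exact_mod_cast hq)
      omega
    have hb := hbound (l, k') (by simp [hk'lt]; omega)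
    set B : ℕ → Finset ℕ := fun m => if m ∈ Q then B₀ else cyclicInterval N t (x m) with hB
    have e1 : ∀ m, discrepancy N t
        (fun b => wave k (((N * m + b : ℕ) : ℝ) / (N ^ (j + 1) : ℕ))) (B m) =
        discrepancy N t (g k' m) (B m) := by
      intro m
      congr 1
      ext b
      exact wave_int_emod hq k _
    simp_rw [e1]
    have split : ∑ m ∈ M with G l m, discrepancy N t (g k' m) (B m) =
        ∑ m ∈ (M ∩ Q) with G l m, discrepancy N t (g k' m) (B m) +
        2 * ∑ m ∈ M \ Q, u (l, k') m (x m) := by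
      have : ∑ m ∈ M \ Q, u (l, k') m (x m) =
          2⁻¹ * ∑ m ∈ (M \ Q) with G l m, discrepancy N t (g k' m) (B m) := by
        rw [sum_filter, mul_sum]
        refine sum_congr rfl fun m hm => ?_
        have : m ∉ Q := (mem_sdiff.1 hm).2
        simp only [u, hB, this, if_false]
        split_ifs <;> simp
      rw [this, mul_inv_cancel_left₀ (by norm_num), sum_filter, sum_filter, sum_filter,
        sum_inter_add_sum_sdiff]
    rw [split]
    refine (norm_add_le _ _).trans ?_
    have b1 : ‖∑ m ∈ (M ∩ Q) with G l m, discrepancy N t (g k' m) (B m)‖ ≤ 2 * L ^ j := by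
      refine (norm_sum_le_of_le (n := fun _ => (2 : ℝ)) _ fun m _ => triv k' m (B m) ?_ ?_).trans ?_
      · simp only [hB]; split_ifs; exacts [hBN, cyclicInterval_subset hN _ _]
      · simp only [hB]; split_ifs; exacts [hBc, card_cyclicInterval htN _]
      · rw [sum_const, nsmul_eq_mul, mul_comm]
        have : #((M ∩ Q).filter (G l)) ≤ L ^ j :=
          (card_filter_le _ _).trans ((card_le_card inter_subset_right).trans hQ)
        have : (#((M ∩ Q).filter (G l)) : ℝ) ≤ L ^ j := by exact_mod_cast this
        linarith
    have c1 : (#(M \ Q) : ℝ) ≤ L ^ j * L ^ j := by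
      have : #(M \ Q) ≤ t ^ j := hM ▸ card_le_card sdiff_subset
      rw [← htL, mul_pow] at this
      exact_mod_cast this
    have c2 : Real.log (4 * #(range (j + 1) ×ˢ range (N ^ (j + 1)))) ≤
        (j + 1) * (3 + Real.log N) := by
      have hN' : (0 : ℝ) < N := by exact_mod_cast hN
      rw [card_product, card_range, card_range]
      push_cast
      rw [Real.log_mul (by norm_num) (by positivity), Real.log_mul (by positivity) (by positivity),
        Real.log_pow]
      have l1 := Real.log_le_sub_one_of_pos (show (0 : ℝ) < j + 1 by positivity)
      have l2 := Real.log_le_sub_one_of_pos (show (0 : ℝ) < 4 by norm_num)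
      have : (0 : ℝ) ≤ j := by positivity
      push_cast
      nlinarith
    have b2 : ‖2 * ∑ m ∈ M \ Q, u (l, k') m (x m)‖ ≤
        4 * ((j + 1) * (3 + Real.log N) * L ^ j + L ^ j / 2) := by
      rw [norm_mul, Complex.norm_ofNat]
      have : Real.log (4 * #(range (j + 1) ×ˢ range (N ^ (j + 1)))) / ((L : ℝ) ^ j)⁻¹ +
          #(M \ Q) * ((L : ℝ) ^ j)⁻¹ / 2 ≤
          (j + 1) * (3 + Real.log N) * L ^ j + L ^ j / 2 := by
        rw [div_inv_eq_mul]
        gcongr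
        rw [← div_eq_mul_inv, div_le_iff₀ hL']
        exact c1
      linarith
    have hj : (L : ℝ) ^ j ≤ (j + 1) * L ^ j := by
      have : (0 : ℝ) ≤ j := by positivity
      nlinarith
    nlinarith

/-! ### Digit trees in integer coordinates -/

/-- The numerators of the left endpoints at level `j`, for digit sets `B j m`. -/
def digitTree (N : ℕ) (B : ℕ → ℕ → Finset ℕ) : ℕ → Finset ℕ
  | 0 => {0}
  | j + 1 => (digitTree N B j).biUnion fun m => (B j m).image fun b => N * m + b

section Tree

variable {N : ℕ} {B : ℕ → ℕ → Finset ℕ}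

theorem mem_digitTree_succ {j n : ℕ} :
    n ∈ digitTree N B (j + 1) ↔ ∃ m ∈ digitTree N B j, ∃ b ∈ B j m, N * m + b = n := by
  simp [digitTree]

theorem digitTree_lt (hB : ∀ j m, B j m ⊆ range N) (j : ℕ) : ∀ m ∈ digitTree N B j, m < N ^ j := by
  induction j with
  | zero => simp [digitTree]
  | succ j ih =>
    intro n hn
    obtain ⟨m, hm, b, hb, rfl⟩ := mem_digitTree_succ.1 hn
    have h1 := ih m hm
    have h2 := mem_range.1 (hB j m hb)
    calc N * m + b < N * (m + 1) := by rw [mul_add]; omega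
      _ ≤ N * N ^ j := Nat.mul_le_mul_left _ h1
      _ = N ^ (j + 1) := (pow_succ' _ _).symm

theorem mul_add_div_self {m b : ℕ} (hb : b < N) : (N * m + b) / N = m := by
  rw [Nat.mul_add_div (by omega), Nat.div_eq_of_lt hb, add_zero]

theorem sum_digitTree_succ {A : Type*} [AddCommMonoid A] (hB : ∀ j m, B j m ⊆ range N) (j : ℕ)
    (f : ℕ → A) : ∑ n ∈ digitTree N B (j + 1), f n =
      ∑ m ∈ digitTree N B j, ∑ b ∈ B j m, f (N * m + b) := by
  rw [digitTree, sum_biUnion]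
  · refine sum_congr rfl fun m _ => sum_image fun b _ b' _ h => ?_
    simpa using h
  · intro m _ m' _ hne
    rw [Function.onFun, disjoint_left]
    intro n hn hn'
    obtain ⟨b, hb, rfl⟩ := mem_image.1 hn
    obtain ⟨b', hb', h⟩ := mem_image.1 hn'
    apply hne
    rw [← mul_add_div_self (m := m) (mem_range.1 (hB j m hb)), ← h,
      mul_add_div_self (mem_range.1 (hB j m' hb'))]

theorem card_digitTree {t : ℕ} (hB : ∀ j m, B j m ⊆ range N) (hBt : ∀ j m, #(B j m) = t) (j : ℕ) :
    #(digitTree N B j) = t ^ j := by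
  induction j with
  | zero => simp [digitTree]
  | succ j ih =>
    rw [card_eq_sum_ones, sum_digitTree_succ hB]
    simp [hBt, ih, pow_succ]

theorem digitTree_mono {B' : ℕ → ℕ → Finset ℕ} (h : ∀ j, ∀ m ∈ digitTree N B j, B j m ⊆ B' j m)
    (j : ℕ) : digitTree N B j ⊆ digitTree N B' j := by
  induction j with
  | zero => simp [digitTree]
  | succ j ih =>
    intro n hn
    obtain ⟨m, hm, b, hb, rfl⟩ := mem_digitTree_succ.1 hn
    exact mem_digitTree_succ.2 ⟨m, ih hm, b, h j m hm hb, rfl⟩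

/-- The digit choice, in the sense of `IsAdmissible`, that corresponds to `B`. -/
noncomputable def digitChoice (N : ℕ) (B : ℕ → ℕ → Finset ℕ) : ℕ → ℝ → Finset ℝ
  -- A dummy value: only the indices `j + 1` enter `endpoints` and `IsAdmissible`.
  | 0, _ => ∅
  | j + 1, a => (B j ⌊a * (N : ℝ) ^ j⌋₊).image fun b : ℕ => (b : ℝ) / (N : ℝ) ^ (j + 1)

theorem digitChoice_succ (hN : 0 < N) (j m : ℕ) : digitChoice N B (j + 1) ((m : ℝ) / (N : ℝ) ^ j) =
    (B j m).image fun b : ℕ => (b : ℝ) / (N : ℝ) ^ (j + 1) := by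
  have : (N : ℝ) ^ j ≠ 0 := by positivity
  rw [digitChoice, div_mul_cancel₀ _ this, Nat.floor_natCast]

theorem div_add_div_pow_succ (hN : 0 < N) (j m b : ℕ) :
    (m : ℝ) / (N : ℝ) ^ j + (b : ℝ) / (N : ℝ) ^ (j + 1) =
      ((N * m + b : ℕ) : ℝ) / (N : ℝ) ^ (j + 1) := by
  have : (N : ℝ) ≠ 0 := by positivity
  push_cast
  field_simp
  ring

theorem endpoints_digitChoice (hN : 0 < N) (j : ℕ) : endpoints (digitChoice N B) j =
    (digitTree N B j).image fun m : ℕ => (m : ℝ) / (N : ℝ) ^ j := by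
  induction j with
  | zero => simp [endpoints, digitTree]
  | succ j ih =>
    rw [endpoints, ih, digitTree, image_biUnion, biUnion_image]
    refine biUnion_congr rfl fun m _ => ?_
    rw [digitChoice_succ hN, image_image, image_image]
    refine image_congr fun b _ => ?_
    exact div_add_div_pow_succ hN j m b

theorem structured_eq (hN : 0 < N) (P : Finset ℕ) (j : ℕ) : structured N P j =
    (digitTree N (fun _ _ => P) j).image fun m : ℕ => (m : ℝ) / (N : ℝ) ^ j := by
  induction j with
  | zero => simp [structured, digitTree]
  | succ j ih =>
    rw [structured, ih, digitTree, image_biUnion, biUnion_image]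
    refine biUnion_congr rfl fun m _ => ?_
    rw [image_image]
    refine image_congr fun b _ => ?_
    exact div_add_div_pow_succ hN j m b

theorem div_pow_injective (hN : 0 < N) (j : ℕ) :
    Function.Injective fun m : ℕ => (m : ℝ) / (N : ℝ) ^ j := by
  intro m m' h
  have : (N : ℝ) ^ j ≠ 0 := by positivity
  simpa [div_left_inj' this] using h

theorem isAdmissible_digitChoice {t : ℕ} (hN : 0 < N) (hB : ∀ j m, B j m ⊆ range N)
    (hBt : ∀ j m, #(B j m) = t) : IsAdmissible N t (digitChoice N B) := by
  intro j a ha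
  rw [endpoints_digitChoice hN] at ha
  obtain ⟨m, -, rfl⟩ := mem_image.1 ha
  rw [digitChoice_succ hN]
  exact ⟨image_subset_image (hB j m),
    by rw [card_image_of_injective _ (div_pow_injective hN _), hBt]⟩

theorem level_succ_subset (hN : 0 < N) (hB : ∀ j m, B j m ⊆ range N) (j : ℕ) :
    level N (digitChoice N B) (j + 1) ⊆ level N (digitChoice N B) j := by
  intro x hx
  simp only [level, endpoints_digitChoice hN, Set.mem_iUnion, mem_image, exists_prop,
    exists_exists_and_eq_and] at hx ⊢
  obtain ⟨n, hn, h1, h2⟩ := hx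
  obtain ⟨m, hm, b, hb, rfl⟩ := mem_digitTree_succ.1 hn
  have hb' : (b : ℝ) + 1 ≤ N := by exact_mod_cast mem_range.1 (hB j m hb)
  have hN' : (0 : ℝ) < N := by exact_mod_cast hN
  have e : 1 / (N : ℝ) ^ j = N / (N : ℝ) ^ (j + 1) := by field_simp; ring
  have h3 : (0 : ℝ) ≤ b / (N : ℝ) ^ (j + 1) := by positivity
  have h4 : ((b : ℝ) + 1) / (N : ℝ) ^ (j + 1) ≤ N / (N : ℝ) ^ (j + 1) := by gcongr
  rw [add_div] at h4
  rw [← div_add_div_pow_succ hN] at h1 h2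
  exact ⟨m, hm, by linarith, by linarith⟩

theorem level_subset (hN : 0 < N) (hB : ∀ j m, B j m ⊆ range N) :
    Antitone (level N (digitChoice N B)) :=
  antitone_nat_of_succ_le fun j => level_succ_subset hN hB j

theorem isClosed_level (D : ℕ → ℝ → Finset ℝ) (j : ℕ) : IsClosed (level N D j) :=
  (endpoints D j).finite_toSet.isClosed_biUnion fun _ _ => isClosed_Icc

/-- Half-open cells of one level are disjoint, so the floor identifies the cell containing `x`, and
`m / N ^ (j - l)` is the ancestor of `m` at level `l`. -/
theorem mem_structuredLevel_iff (hN : 0 < N) (P : Finset ℕ) {l j m : ℕ} (hl : l ≤ j) {x : ℝ}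
    (hx : x ∈ Set.Ico ((m : ℝ) / (N : ℝ) ^ j) ((m : ℝ) / (N : ℝ) ^ j + 1 / (N : ℝ) ^ j)) :
    x ∈ structuredLevel N P l ↔ m / N ^ (j - l) ∈ digitTree N (fun _ _ => P) l := by
  have hN' : (0 : ℝ) < N := by exact_mod_cast hN
  have hx0 : 0 ≤ x := le_trans (by positivity) hx.1
  have key : ∀ i n : ℕ,
      x ∈ Set.Ico ((n : ℝ) / (N : ℝ) ^ i) ((n : ℝ) / (N : ℝ) ^ i + 1 / (N : ℝ) ^ i) ↔
        ⌊x * (N : ℝ) ^ i⌋₊ = n := by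
    intro i n
    rw [Nat.floor_eq_iff (by positivity), Set.mem_Ico, ← add_div, div_le_iff₀ (by positivity),
      lt_div_iff₀ (by positivity)]
  have hm := (key j m).1 hx
  have hfl : ⌊x * (N : ℝ) ^ l⌋₊ = m / N ^ (j - l) := by
    rw [← hm, ← Nat.floor_div_natCast]
    congr 1
    push_cast
    rw [eq_div_iff (by positivity), mul_assoc, ← pow_add]
    congr 2; omega
  simp only [structuredLevel, structured_eq hN, Set.mem_iUnion, mem_image, exists_prop,
    exists_exists_and_eq_and, key, hfl]
  simp

theorem mul_add_div_pow {l j m b : ℕ} (hl : l ≤ j) (hb : b < N) :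
    (N * m + b) / N ^ (j + 1 - l) = m / N ^ (j - l) := by
  rw [show j + 1 - l = (j - l) + 1 by omega, pow_succ', ← Nat.div_div_eq_div_mul,
    mul_add_div_self hb]

end Tree

theorem exists_digitTree {N t L : ℕ} (hN : 0 < N) (hL : 0 < L) (htL : L * L = t) (htN : t ≤ N)
    {P : Finset ℕ} (hP : P ⊆ range N) (hPc : #P = L) :
    ∃ B : ℕ → ℕ → Finset ℕ, (∀ j m, B j m ⊆ range N) ∧ (∀ j m, #(B j m) = t) ∧
      (∀ j, ∀ m ∈ digitTree N (fun _ _ => P) j, P ⊆ B j m) ∧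
      ∀ j, ∀ l ≤ j, ∀ k : ℤ,
        ‖∑ m ∈ digitTree N B j with m / N ^ (j - l) ∈ digitTree N (fun _ _ => P) l,
          discrepancy N t
            (fun b => wave k (((N * m + b : ℕ) : ℝ) / (N : ℝ) ^ (j + 1))) (B j m)‖ ≤
          (16 + 4 * Real.log N) * (j + 1) * L ^ j := by
  have hQ : ∀ j, #(digitTree N (fun _ _ => P) j) = L ^ j :=
    card_digitTree (fun _ _ => hP) (fun _ _ => hPc)
  -- The cardinality condition sits inside the conclusion so that a choice function exists for every
  -- `M`, before the tree is known.
  have step : ∀ j (M : Finset ℕ), ∃ B : ℕ → Finset ℕ, (∀ m, B m ⊆ range N) ∧ (∀ m, #(B m) = t) ∧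
      (∀ m ∈ digitTree N (fun _ _ => P) j, P ⊆ B m) ∧ (#M = t ^ j → ∀ l ≤ j, ∀ k : ℤ,
        ‖∑ m ∈ M with m / N ^ (j - l) ∈ digitTree N (fun _ _ => P) l, discrepancy N t
            (fun b => wave k (((N * m + b : ℕ) : ℝ) / (N : ℝ) ^ (j + 1))) (B m)‖ ≤
          (16 + 4 * Real.log N) * (j + 1) * L ^ j) := by
    intro j M
    by_cases hM : #M = t ^ j
    · obtain ⟨B, h1, h2, h3⟩ := exists_digits hN hL htL htN hP hPc j M _ hM (hQ j).le
        (fun l m => m / N ^ (j - l) ∈ digitTree N (fun _ _ => P) l)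
      exact ⟨B, fun m => (h1 m).1, fun m => (h1 m).2, h2, fun _ => by simpa using h3⟩
    · obtain ⟨B₀, hPB, hBN, hBc⟩ := exists_subsuperset_card_eq hP
        (show #P ≤ t by rw [hPc, ← htL]; exact Nat.le_mul_of_pos_left L hL) (by simpa using htN)
      exact ⟨fun _ => B₀, fun _ => hBN, fun _ => hBc, fun _ _ => hPB, fun h => absurd h hM⟩
  choose S hS1 hS2 hS3 hS4 using step
  -- The digits at level `j` depend on the tree they extend; this recursion builds the node sets
  -- first, and the tree is then identified with them.
  let M : ℕ → Finset ℕ := fun j => Nat.rec {0}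
    (fun j M => M.biUnion fun m => (S j M m).image fun b => N * m + b) j
  have hM : ∀ j, digitTree N (fun j => S j (M j)) j = M j := by
    intro j
    induction j with
    | zero => rfl
    | succ j ih => rw [digitTree, ih]
  refine ⟨fun j => S j (M j), fun j => hS1 j _, fun j => hS2 j _, fun j => hS3 j _, fun j => ?_⟩
  have := hS4 j (M j) (by rw [← hM]; exact card_digitTree (fun j => hS1 j _) (fun j => hS2 j _) j)
  rwa [hM]

/-! ### Fourier transforms of trees and their increments -/

/-- The mean of the character `wave ξ` over `[0, N^{-j}]`. -/
noncomputable def cellMean (N j : ℕ) (ξ : ℝ) : ℂ :=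
  (N : ℂ) ^ j * ∫ x in (0 : ℝ)..1 / (N : ℝ) ^ j, wave ξ x

theorem integral_wave_add (ξ a h : ℝ) :
    ∫ x in a..(a + h), wave ξ x = wave ξ a * ∫ x in (0 : ℝ)..h, wave ξ x := by
  have := intervalIntegral.integral_comp_add_left (a := 0) (b := h) (wave ξ) a
  rw [add_zero] at this
  rw [← this]
  simp_rw [wave_add, intervalIntegral.integral_const_mul]

theorem norm_integral_wave_le {ξ : ℝ} (hξ : ξ ≠ 0) (h : ℝ) :
    ‖∫ x in (0 : ℝ)..h, wave ξ x‖ ≤ |ξ|⁻¹ := by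
  have hc : (-2 * Real.pi * Complex.I * ξ : ℂ) ≠ 0 := by
    simp [hξ, Real.pi_ne_zero]
  have e : ∫ x in (0 : ℝ)..h, wave ξ x = (wave ξ h - wave ξ 0) / (-2 * Real.pi * Complex.I * ξ) :=
    integral_exp_mul_complex hc
  have hn : ‖(-2 * Real.pi * Complex.I * ξ : ℂ)‖ = 2 * Real.pi * |ξ| := by
    simp [Real.pi_pos.le]
  have h2 : ‖wave ξ h - wave ξ 0‖ ≤ 2 := (norm_sub_le _ _).trans (by norm_num)
  have hξ' : 0 < |ξ| := abs_pos.2 hξ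
  rw [e, norm_div, hn, div_le_iff₀ (by positivity)]
  refine h2.trans ?_
  rw [mul_comm, mul_assoc, mul_inv_cancel₀ hξ'.ne']
  linarith [Real.pi_gt_three]

theorem norm_cellMean_le_one {N : ℕ} (hN : 0 < N) (j : ℕ) (ξ : ℝ) : ‖cellMean N j ξ‖ ≤ 1 := by
  have hp : (0 : ℝ) < (N : ℝ) ^ j := by positivity
  have := intervalIntegral.norm_integral_le_of_norm_le_const (a := 0) (b := 1 / (N : ℝ) ^ j)
    (f := wave ξ) (C := 1) (fun x _ => by simp)
  rw [sub_zero, one_mul, abs_of_pos (by positivity), le_div_iff₀ hp, mul_comm] at this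
  rwa [cellMean, norm_mul, norm_pow, Complex.norm_natCast]

theorem norm_cellMean_le {N : ℕ} {ξ : ℝ} (hξ : ξ ≠ 0) (j : ℕ) :
    ‖cellMean N j ξ‖ ≤ (N : ℝ) ^ j * |ξ|⁻¹ := by
  rw [cellMean, norm_mul, norm_pow, Complex.norm_natCast]
  gcongr
  exact norm_integral_wave_le hξ _

/-- Interpolation between the trivial bound and the `|ξ|⁻¹` bound: `min 1 x ≤ x ^ γ` for `0 ≤ γ ≤
1`. -/
theorem norm_cellMean_le_rpow {N : ℕ} (hN : 0 < N) {ξ : ℝ} (hξ : ξ ≠ 0) (j : ℕ) {γ : ℝ}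
    (h0 : 0 ≤ γ) (h1 : γ ≤ 1) :
    ‖cellMean N j ξ‖ ≤ ((N : ℝ) ^ γ) ^ j * |ξ| ^ (-γ) := by
  have hx : 0 < (N : ℝ) ^ j * |ξ|⁻¹ := by
    have := abs_pos.2 hξ
    positivity
  have e : ((N : ℝ) ^ γ) ^ j * |ξ| ^ (-γ) = ((N : ℝ) ^ j * |ξ|⁻¹) ^ γ := by
    rw [Real.mul_rpow (by positivity) (by positivity), Real.rpow_neg (abs_nonneg _),
      Real.inv_rpow (abs_nonneg _), ← Real.rpow_natCast, ← Real.rpow_natCast, ← Real.rpow_mul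
      (by positivity), ← Real.rpow_mul (by positivity), mul_comm γ]
  rw [e]
  rcases le_total 1 ((N : ℝ) ^ j * |ξ|⁻¹) with h | h
  · exact (norm_cellMean_le_one hN j ξ).trans (Real.one_le_rpow h h0)
  · refine (norm_cellMean_le hξ j).trans ?_
    simpa using Real.rpow_le_rpow_of_exponent_ge hx h h1

theorem cellMean_eq {N : ℕ} (hN : 0 < N) (j : ℕ) (ξ : ℝ) : cellMean N j ξ =
    (N : ℂ)⁻¹ * ∑ b ∈ range N, wave ξ (b / (N : ℝ) ^ (j + 1)) * cellMean N (j + 1) ξ := by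
  have hN' : (N : ℝ) ≠ 0 := by positivity
  have hNc : (N : ℂ) ≠ 0 := by exact_mod_cast hN'
  have h := intervalIntegral.sum_integral_adjacent_intervals (f := wave ξ) (μ := volume) (n := N)
    (a := fun b : ℕ => (b : ℝ) / (N : ℝ) ^ (j + 1))
    (fun b _ => (continuous_wave ξ).intervalIntegrable _ _)
  have e1 : (N : ℝ) / (N : ℝ) ^ (j + 1) = 1 / (N : ℝ) ^ j := by field_simp; ring
  have e2 : ∀ b : ℕ, ((b + 1 : ℕ) : ℝ) / (N : ℝ) ^ (j + 1) =
      b / (N : ℝ) ^ (j + 1) + 1 / (N : ℝ) ^ (j + 1) := by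
    intro b; push_cast; rw [add_div]
  simp only [e1, e2, integral_wave_add, Nat.cast_zero, zero_div] at h
  rw [cellMean, ← h, ← sum_mul, ← sum_mul, cellMean, pow_succ]
  field_simp
  ring

/-- The Fourier transform of `t^{-j}` times the sum of the normalised Lebesgue measures on
`[m N^{-j}, (m + 1) N^{-j}]`, `m ∈ s`. -/
noncomputable def treeTransform (N t : ℕ) (s : Finset ℕ) (j : ℕ) (ξ : ℝ) : ℂ :=
  ((t : ℂ) ^ j)⁻¹ * ∑ m ∈ s, wave ξ (m / (N : ℝ) ^ j) * cellMean N j ξ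

theorem norm_treeTransform_le {N t : ℕ} (ht : 0 < t) {s : Finset ℕ} {j : ℕ} (hs : #s ≤ t ^ j)
    (ξ : ℝ) : ‖treeTransform N t s j ξ‖ ≤ ‖cellMean N j ξ‖ := by
  rw [treeTransform, norm_mul, norm_inv, norm_pow, Complex.norm_natCast,
    inv_mul_le_iff₀ (by positivity)]
  refine (norm_sum_le _ _).trans ?_
  simp only [norm_mul, norm_wave, one_mul, sum_const, nsmul_eq_mul]
  gcongr
  exact_mod_cast hs

/-- By `cellMean_eq`, refining a cell with all `N` digits changes nothing, so only the deviation of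
the chosen digits from uniform remains. -/
theorem treeTransform_sub {N t : ℕ} (hN : 0 < N) {s s' : Finset ℕ} {j : ℕ} {B : ℕ → Finset ℕ}
    (hs : ∀ f : ℕ → ℂ, ∑ n ∈ s', f n = ∑ m ∈ s, ∑ b ∈ B m, f (N * m + b)) (ξ : ℝ) :
    treeTransform N t s' (j + 1) ξ - treeTransform N t s j ξ =
      ((t : ℂ) ^ j)⁻¹ * cellMean N (j + 1) ξ * ∑ m ∈ s, discrepancy N t
        (fun b => wave ξ (((N * m + b : ℕ) : ℝ) / (N : ℝ) ^ (j + 1))) (B m) := by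
  have e : ∀ m : ℕ, wave ξ (m / (N : ℝ) ^ j) * cellMean N j ξ = (N : ℂ)⁻¹ * ∑ b ∈ range N,
      wave ξ (((N * m + b : ℕ) : ℝ) / (N : ℝ) ^ (j + 1)) * cellMean N (j + 1) ξ := by
    intro m
    rw [cellMean_eq hN, mul_left_comm, mul_sum]
    congr 1
    refine sum_congr rfl fun b _ => ?_
    rw [← div_add_div_pow_succ hN, wave_add, mul_assoc]
  simp_rw [treeTransform, e, hs, discrepancy, sum_sub_distrib, ← sum_mul, ← mul_sum, ← sum_mul]
  rw [pow_succ, mul_inv]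
  ring

/-- A character is nearly constant on a cell of length `N^{-j}`. This crude bound holds at every
real frequency, as weak convergence requires; the random estimate covers integers only. -/
theorem norm_treeTransform_sub_le {N t : ℕ} (hN : 0 < N) (ht : 0 < t) {s s' : Finset ℕ} {j : ℕ}
    {B : ℕ → Finset ℕ} (hB : ∀ m, B m ⊆ range N) (hBt : ∀ m, #(B m) = t) (hst : #s ≤ t ^ j)
    (hs : ∀ f : ℕ → ℂ, ∑ n ∈ s', f n = ∑ m ∈ s, ∑ b ∈ B m, f (N * m + b)) (ξ : ℝ) :
    ‖treeTransform N t s' (j + 1) ξ - treeTransform N t s j ξ‖ ≤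
      4 * Real.pi * |ξ| * ((N : ℝ)⁻¹) ^ j := by
  have hN' : (0 : ℝ) < N := by exact_mod_cast hN
  rw [treeTransform_sub hN hs, norm_mul, norm_mul, norm_inv, norm_pow, Complex.norm_natCast]
  have hd : ∀ m ∈ s, ‖discrepancy N t
      (fun b => wave ξ (((N * m + b : ℕ) : ℝ) / (N : ℝ) ^ (j + 1))) (B m)‖ ≤
      2 * (2 * Real.pi * |ξ| * ((N : ℝ)⁻¹) ^ j) := by
    intro m _
    refine norm_discrepancy_le hN ht (hB m) (hBt m) (z := wave ξ (m / (N : ℝ) ^ j)) fun b hb => ?_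
    have hb' : (b : ℝ) ≤ N := by exact_mod_cast (mem_range.1 hb).le
    rw [← div_add_div_pow_succ hN, wave_add, ← mul_sub_one, norm_mul, norm_wave, one_mul]
    refine (norm_wave_sub_one_le _ _).trans ?_
    gcongr
    rw [abs_of_nonneg (by positivity), div_le_iff₀ (by positivity), pow_succ, ← mul_assoc,
      inv_pow, inv_mul_cancel₀ (by positivity), one_mul]
    exact hb'
  have hsum := norm_sum_le_of_le _ hd
  rw [sum_const, nsmul_eq_mul] at hsum
  have hst' : (#s : ℝ) ≤ (t : ℝ) ^ j := by exact_mod_cast hst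
  have ht' : (0 : ℝ) < (t : ℝ) ^ j := by positivity
  have hX : 0 ≤ 2 * (2 * Real.pi * |ξ| * ((N : ℝ)⁻¹) ^ j) := by have := Real.pi_pos; positivity
  calc _ ≤ ((t : ℝ) ^ j)⁻¹ * 1 * ((t : ℝ) ^ j * (2 * (2 * Real.pi * |ξ| * ((N : ℝ)⁻¹) ^ j))) := by
        gcongr
        · exact norm_cellMean_le_one hN _ _
        · exact hsum.trans (by gcongr)
    _ = _ := by field_simp; ring

/-! ### The level measures and their transforms -/

section Measure

variable {N t : ℕ} {B : ℕ → ℕ → Finset ℕ}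

theorem levelMeasure_eq (D : ℕ → ℝ → Finset ℝ) (j : ℕ) : levelMeasure N t D j =
    ∑ a ∈ endpoints D j, ENNReal.ofReal (((t : ℝ) ^ j)⁻¹ * (N : ℝ) ^ j) •
      volume.restrict (Set.Icc a (a + 1 / (N : ℝ) ^ j)) := by
  have h : ∀ x, ENNReal.ofReal (density N t D j x) = ∑ a ∈ endpoints D j,
      (Set.Icc a (a + 1 / (N : ℝ) ^ j)).indicator
        (fun _ => ENNReal.ofReal (((t : ℝ) ^ j)⁻¹ * (N : ℝ) ^ j)) x := by
    intro x
    rw [density, ENNReal.ofReal_sum_of_nonneg]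
    · refine sum_congr rfl fun a _ => ?_
      by_cases hx : x ∈ Set.Icc a (a + 1 / (N : ℝ) ^ j)
      · rw [Set.indicator_of_mem hx, Set.indicator_of_mem hx, mul_one]
      · rw [Set.indicator_of_notMem hx, Set.indicator_of_notMem hx, mul_zero, ENNReal.ofReal_zero]
    · intro a _
      exact mul_nonneg (by positivity) (Set.indicator_nonneg (fun _ _ => zero_le_one) _)
  ext s hs
  simp_rw [levelMeasure, h]
  rw [withDensity_apply _ hs, lintegral_finsetSum _
    (fun a _ => measurable_const.indicator measurableSet_Icc), Measure.finsetSum_apply]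
  refine sum_congr rfl fun a _ => ?_
  rw [lintegral_indicator measurableSet_Icc, setLIntegral_const, Measure.smul_apply, smul_eq_mul]
  rw [Measure.restrict_apply measurableSet_Icc, Measure.restrict_apply hs, Set.inter_comm]

theorem isProbabilityMeasure_levelMeasure (hN : 0 < N) (ht : 0 < t)
    (hB : ∀ j m, B j m ⊆ range N) (hBt : ∀ j m, #(B j m) = t) (j : ℕ) :
    IsProbabilityMeasure (levelMeasure N t (digitChoice N B) j) := by
  constructor
  have hN' : (0 : ℝ) < (N : ℝ) ^ j := by positivity
  have ht' : (0 : ℝ) < (t : ℝ) ^ j := by positivity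
  rw [levelMeasure_eq, endpoints_digitChoice hN, Measure.finsetSum_apply,
    sum_image fun _ _ _ _ h => div_pow_injective hN j h]
  simp only [Measure.smul_apply, Measure.restrict_apply_univ, Real.volume_Icc, smul_eq_mul,
    add_sub_cancel_left, sum_const, card_digitTree hB hBt, nsmul_eq_mul]
  rw [← ENNReal.ofReal_mul (by positivity), ← ENNReal.ofReal_natCast,
    ← ENNReal.ofReal_mul (by positivity), ENNReal.ofReal_eq_one]
  push_cast
  field_simp

theorem levelMeasure_compl_level (D : ℕ → ℝ → Finset ℝ) (j : ℕ) :
    levelMeasure N t D j (level N D j)ᶜ = 0 := by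
  rw [levelMeasure_eq, Measure.finsetSum_apply]
  refine sum_eq_zero fun a ha => ?_
  rw [Measure.smul_apply, Measure.restrict_apply (isClosed_level D j).measurableSet.compl]
  have : (level N D j)ᶜ ∩ Set.Icc a (a + 1 / (N : ℝ) ^ j) = ∅ := by
    rw [← Set.disjoint_iff_inter_eq_empty, Set.disjoint_compl_left_iff_subset]
    exact Set.subset_biUnion_of_mem (u := fun a => Set.Icc a (a + 1 / (N : ℝ) ^ j)) ha
  rw [this, measure_empty, smul_zero]

theorem integral_levelMeasure (hN : 0 < N) (j : ℕ) {g : ℝ → ℂ}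
    (hg : ∀ a ∈ endpoints (digitChoice N B) j,
      IntegrableOn g (Set.Icc a (a + 1 / (N : ℝ) ^ j))) :
    ∫ x, g x ∂(levelMeasure N t (digitChoice N B) j) = ((t : ℂ) ^ j)⁻¹ * ∑ m ∈ digitTree N B j,
      (N : ℂ) ^ j * ∫ x in Set.Ico ((m : ℝ) / (N : ℝ) ^ j)
        ((m : ℝ) / (N : ℝ) ^ j + 1 / (N : ℝ) ^ j), g x := by
  rw [levelMeasure_eq, integral_finsetSum_measure, endpoints_digitChoice hN,
    sum_image fun _ _ _ _ h => div_pow_injective hN j h, mul_sum]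
  · refine sum_congr rfl fun m _ => ?_
    rw [integral_smul_measure, ENNReal.toReal_ofReal (by positivity), integral_Icc_eq_integral_Ico,
      Complex.real_smul]
    push_cast
    rw [mul_assoc]
  · intro a ha
    exact (hg a ha).smul_measure ENNReal.ofReal_ne_top

theorem integral_Ico_wave (j m : ℕ) (ξ : ℝ) : (N : ℂ) ^ j * ∫ x in Set.Ico ((m : ℝ) / (N : ℝ) ^ j)
    ((m : ℝ) / (N : ℝ) ^ j + 1 / (N : ℝ) ^ j), wave ξ x =
    wave ξ (m / (N : ℝ) ^ j) * cellMean N j ξ := by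
  rw [← integral_Icc_eq_integral_Ico, integral_Icc_eq_integral_Ioc,
    ← intervalIntegral.integral_of_le (le_add_of_nonneg_right (by positivity)),
    integral_wave_add, cellMean]
  ring

theorem fourierMeasure_levelMeasure (hN : 0 < N) (j : ℕ) (ξ : ℝ) :
    fourierMeasure (levelMeasure N t (digitChoice N B) j) ξ =
      treeTransform N t (digitTree N B j) j ξ := by
  have := integral_levelMeasure (t := t) (B := B) hN j (g := wave ξ)
    (fun a _ => (continuous_wave ξ).integrableOn_Icc)
  simp_rw [integral_Ico_wave] at this
  exact this

theorem measurableSet_structuredLevel (P : Finset ℕ) (l : ℕ) :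
    MeasurableSet (structuredLevel N P l) :=
  Finset.measurableSet_biUnion _ fun _ _ => measurableSet_Ico

theorem fourierWeighted_levelMeasure (hN : 0 < N) (P : Finset ℕ) {l j : ℕ} (hl : l ≤ j) (ξ : ℝ) :
    fourierWeighted (charFn N P l) (levelMeasure N t (digitChoice N B) j) ξ =
      treeTransform N t ((digitTree N B j).filter
        fun m => m / N ^ (j - l) ∈ digitTree N (fun _ _ => P) l) j ξ := by
  have hg : (fun x => (charFn N P l x : ℂ) * wave ξ x) =
      (structuredLevel N P l).indicator (wave ξ) := by
    ext x
    by_cases hx : x ∈ structuredLevel N P l <;> simp [charFn, hx]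
  have h := integral_levelMeasure (t := t) (B := B) hN j
    (g := fun x => (charFn N P l x : ℂ) * wave ξ x) (fun a _ => by
      rw [hg]
      exact (continuous_wave ξ).integrableOn_Icc.indicator (measurableSet_structuredLevel P l))
  refine h.trans ?_
  rw [treeTransform, sum_filter]
  congr 1
  refine sum_congr rfl fun m _ => ?_
  split_ifs with hm
  · rw [← integral_Ico_wave]
    congr 1
    refine setIntegral_congr_fun measurableSet_Ico fun x hx => ?_
    simp [charFn, (mem_structuredLevel_iff hN P hl hx).2 hm]
  · rw [mul_eq_zero]
    right
    refine setIntegral_eq_zero_of_forall_eq_zero fun x hx => ?_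
    simp [charFn, mt (mem_structuredLevel_iff hN P hl hx).1 hm]

end Measure

/-! ### Weak convergence and support of the limit -/

theorem fourierMeasure_eq_charFun (ν : Measure ℝ) (ξ : ℝ) :
    fourierMeasure ν ξ = charFun ν (-2 * Real.pi * ξ) := by
  rw [charFun_apply_real, fourierMeasure]
  congr 1
  ext x
  congr 1
  push_cast
  ring

/-- Probability measures on a fixed compact set whose characteristic functions converge pointwise
converge weakly. -/
theorem exists_tendsto_of_tendsto_charFun {μ : ℕ → ProbabilityMeasure ℝ} {K : Set ℝ}
    (hK : IsCompact K) (hμK : ∀ n, (μ n : Measure ℝ) Kᶜ = 0)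
    (h : ∀ ξ, ∃ z, Tendsto (fun n => charFun (μ n : Measure ℝ) ξ) atTop (𝓝 z)) :
    ∃ μ₀, Tendsto μ atTop (𝓝 μ₀) := by
  have tight : IsTightMeasureSet {((ν : ProbabilityMeasure ℝ) : Measure ℝ) | ν ∈ Set.range μ} := by
    rw [isTightMeasureSet_iff_exists_isCompact_measure_compl_le]
    intro ε _
    refine ⟨K, hK, ?_⟩
    rintro _ ⟨_, ⟨n, rfl⟩, rfl⟩
    simp [hμK n]
  -- Prokhorov compactness gives a limit along an ultrafilter; its characteristic function must be
  -- the pointwise limit, which forces convergence of the whole sequence.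
  obtain ⟨μ₀, -, hμ₀⟩ := (isCompact_closure_of_isTightMeasureSet tight).ultrafilter_le_nhds
    ((hyperfilter ℕ).map μ) (le_principal_iff.2
      (mem_map.2 (univ_mem' fun n => subset_closure (Set.mem_range_self n))))
  have hμ₀' : Tendsto μ (hyperfilter ℕ : Filter ℕ) (𝓝 μ₀) := hμ₀
  refine ⟨μ₀, ProbabilityMeasure.tendsto_of_tendsto_charFun fun ξ => ?_⟩
  obtain ⟨z, hz⟩ := h ξ
  have h1 : Tendsto (fun n => charFun (μ n : Measure ℝ) ξ) (hyperfilter ℕ : Filter ℕ)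
      (𝓝 (charFun (μ₀ : Measure ℝ) ξ)) := by
    rw [ProbabilityMeasure.tendsto_iff_forall_integral_rclike_tendsto ℂ] at hμ₀'
    simp_rw [charFun_eq_integral_innerProbChar]
    exact hμ₀' (BoundedContinuousFunction.innerProbChar ξ)
  rwa [tendsto_nhds_unique h1 (hz.mono_left Nat.hyperfilter_le_atTop)]

theorem exists_weakLimit {N t : ℕ} (hN : 1 < N) (ht : 0 < t) {B : ℕ → ℕ → Finset ℕ}
    (hB : ∀ j m, B j m ⊆ range N) (hBt : ∀ j m, #(B j m) = t) :
    ∃ μ : Measure ℝ, IsProbabilityMeasure μ ∧ IsWeakLimit (levelMeasure N t (digitChoice N B)) μ ∧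
      μ (cantorSet N (digitChoice N B))ᶜ = 0 ∧
      ∀ ξ, Tendsto (fun j => treeTransform N t (digitTree N B j) j ξ) atTop
        (𝓝 (fourierMeasure μ ξ)) := by
  have hN0 : 0 < N := by omega
  let ν : ℕ → ProbabilityMeasure ℝ := fun j =>
    ⟨levelMeasure N t (digitChoice N B) j, isProbabilityMeasure_levelMeasure hN0 ht hB hBt j⟩
  have hsupp : ∀ i j, i ≤ j → (ν j : Measure ℝ) (level N (digitChoice N B) i)ᶜ = 0 := fun i j hij =>
    measure_mono_null (Set.compl_subset_compl.2 (level_subset hN0 hB hij))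
      (levelMeasure_compl_level _ j)
  have hcpt : IsCompact (level N (digitChoice N B) 0) :=
    (endpoints _ 0).finite_toSet.isCompact_biUnion fun _ _ => isCompact_Icc
  have htree : ∀ j ξ, charFun (ν j : Measure ℝ) (-2 * Real.pi * ξ) =
      treeTransform N t (digitTree N B j) j ξ := fun j ξ => by
    rw [← fourierMeasure_eq_charFun]
    exact fourierMeasure_levelMeasure hN0 j ξ
  have hconv : ∀ ξ, ∃ z, Tendsto (fun j => treeTransform N t (digitTree N B j) j ξ) atTop (𝓝 z) := by
    intro ξ
    refine cauchySeq_tendsto_of_complete (cauchySeq_of_le_geometric (N : ℝ)⁻¹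
      (4 * Real.pi * |ξ|) (inv_lt_one_of_one_lt₀ (by exact_mod_cast hN)) fun j => ?_)
    rw [dist_comm, dist_eq_norm]
    exact norm_treeTransform_sub_le hN0 ht (hB j) (hBt j) (card_digitTree hB hBt j).le
      (sum_digitTree_succ hB j) ξ
  obtain ⟨μ, hμ⟩ := exists_tendsto_of_tendsto_charFun (μ := ν) hcpt (fun j => hsupp 0 j j.zero_le)
    (fun ξ => by
      obtain ⟨z, hz⟩ := hconv (ξ / (-2 * Real.pi))
      refine ⟨z, hz.congr fun j => ?_⟩
      rw [← htree, mul_div_cancel₀ _ (by simp [Real.pi_ne_zero])])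
  refine ⟨μ, inferInstance, ?_, ?_, fun ξ => ?_⟩
  · exact ProbabilityMeasure.tendsto_iff_forall_integral_tendsto.1 hμ
  -- Portmanteau for the open complement of a level, which is null for all later measures.
  · have hlevel : ∀ i, (μ : Measure ℝ) (level N (digitChoice N B) i)ᶜ = 0 := by
      intro i
      rw [← nonpos_iff_eq_zero]
      refine (ProbabilityMeasure.le_liminf_measure_open_of_tendsto hμ
        (isClosed_level _ i).isOpen_compl).trans (le_of_eq ?_)
      exact ((tendsto_congr' (eventually_atTop.2 ⟨i, fun j hj => hsupp i j hj⟩)).2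
        tendsto_const_nhds).liminf_eq
    rw [cantorSet, Set.compl_iInter₂]
    exact measure_iUnion_null fun i => measure_iUnion_null fun _ => hlevel i
  · rw [fourierMeasure_eq_charFun]
    exact (ProbabilityMeasure.tendsto_iff_tendsto_charFun.1 hμ _).congr fun j => htree j ξ

/-! ### Summing the increments -/

theorem norm_le_add_sum_of_norm_sub_le {a : ℕ → ℂ} {c : ℕ → ℝ} (hc : ∀ j, 0 ≤ c j) {l j : ℕ}
    (hlj : l ≤ j) (h : ∀ j, l ≤ j → ‖a (j + 1) - a j‖ ≤ c j) :
    ‖a j‖ ≤ ‖a l‖ + ∑ i ∈ range j, c i := by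
  induction j, hlj using Nat.le_induction with
  | base => exact le_add_of_nonneg_right (sum_nonneg fun i _ => hc i)
  | succ j hlj ih =>
    rw [sum_range_succ, ← sub_add_cancel (a (j + 1)) (a j)]
    exact (norm_add_le _ _).trans (by linarith [h j hlj])

/-- The constant in the Fourier decay estimate at exponent `γ` for the measures weighted by the
characteristic function of the `l`-th structured level. -/
noncomputable def decayConst (N L : ℕ) (γ : ℝ) (l : ℕ) : ℝ :=
  ((N : ℝ) ^ γ) ^ l +
    ∑' j : ℕ, (16 + 4 * Real.log N) * (N : ℝ) ^ γ * ((j + 1) * ((N : ℝ) ^ γ / L) ^ j)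

theorem summable_succ_mul_pow {r : ℝ} (h0 : 0 ≤ r) (h1 : r < 1) :
    Summable fun j : ℕ => ((j : ℝ) + 1) * r ^ j := by
  have hr : ‖r‖ < 1 := by rwa [Real.norm_of_nonneg h0]
  have := (summable_pow_mul_geometric_of_norm_lt_one 1 hr).add
    (summable_geometric_of_norm_lt_one hr)
  refine this.congr fun j => ?_
  ring

/-- Telescoping starts at `l`, since only from there on do children inherit the restriction from
their parents; the initial term `N^{γ l}` is the sole source of dependence on `l`. In the
increments, `t^{-j} = L^{-2j}` against `L^j` leaves the ratio `N^γ / L`. -/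
theorem norm_treeTransform_filter_le {N t L : ℕ} (hN : 0 < N) (hL : 0 < L) (htL : L * L = t)
    {P : Finset ℕ} {B : ℕ → ℕ → Finset ℕ}
    (hB : ∀ j m, B j m ⊆ range N) (hBt : ∀ j m, #(B j m) = t)
    (hdisc : ∀ j, ∀ l ≤ j, ∀ k : ℤ,
        ‖∑ m ∈ digitTree N B j with m / N ^ (j - l) ∈ digitTree N (fun _ _ => P) l,
          discrepancy N t
            (fun b => wave k (((N * m + b : ℕ) : ℝ) / (N : ℝ) ^ (j + 1))) (B j m)‖ ≤
          (16 + 4 * Real.log N) * (j + 1) * L ^ j)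
    {γ : ℝ} (h0 : 0 ≤ γ) (h1 : γ ≤ 1) (hγ : (N : ℝ) ^ γ < L) {l j : ℕ} (hlj : l ≤ j) {k : ℤ}
    (hk : k ≠ 0) :
    ‖treeTransform N t ((digitTree N B j).filter
        fun m => m / N ^ (j - l) ∈ digitTree N (fun _ _ => P) l) j k‖ ≤
      decayConst N L γ l * |(k : ℝ)| ^ (-γ) := by
  have ht : 0 < t := htL ▸ Nat.mul_pos hL hL
  have hL' : (0 : ℝ) < L := by exact_mod_cast hL
  have hN1 : (1 : ℝ) ≤ N := by exact_mod_cast hN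
  have hk' : (k : ℝ) ≠ 0 := by exact_mod_cast hk
  have hC : 0 ≤ 16 + 4 * Real.log N := by have := Real.log_nonneg hN1; positivity
  have hkγ : 0 ≤ |(k : ℝ)| ^ (-γ) := by positivity
  set c : ℕ → ℝ := fun j =>
    (16 + 4 * Real.log N) * (N : ℝ) ^ γ * ((j + 1) * ((N : ℝ) ^ γ / L) ^ j) with hcdef
  have hc0 : ∀ j, 0 ≤ c j := fun j => by positivity
  have hcs : Summable c := (summable_succ_mul_pow (by positivity)
    ((div_lt_one hL').2 hγ)).mul_left _
  let s : ℕ → Finset ℕ := fun j => (digitTree N B j).filter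
    fun m => m / N ^ (j - l) ∈ digitTree N (fun _ _ => P) l
  have hcard : ∀ j, #(s j) ≤ t ^ j := fun j =>
    (card_filter_le _ _).trans (card_digitTree hB hBt j).le
  have hsum : ∀ j, l ≤ j → ∀ f : ℕ → ℂ,
      ∑ n ∈ s (j + 1), f n = ∑ m ∈ s j, ∑ b ∈ B j m, f (N * m + b) := by
    intro j hj f
    rw [sum_filter, sum_filter, sum_digitTree_succ hB]
    refine sum_congr rfl fun m _ => ?_
    rw [sum_congr rfl fun b hb => by rw [mul_add_div_pow hj (mem_range.1 (hB j m hb))]]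
    split_ifs <;> simp
  have hinc : ∀ j, l ≤ j → ‖treeTransform N t (s (j + 1)) (j + 1) k - treeTransform N t (s j) j k‖ ≤
      c j * |(k : ℝ)| ^ (-γ) := by
    intro j hj
    rw [treeTransform_sub hN (hsum j hj), norm_mul, norm_mul, norm_inv, norm_pow,
      Complex.norm_natCast]
    calc _ ≤ ((t : ℝ) ^ j)⁻¹ * (((N : ℝ) ^ γ) ^ (j + 1) * |(k : ℝ)| ^ (-γ)) *
          ((16 + 4 * Real.log N) * (j + 1) * L ^ j) := by
          gcongr
          · exact norm_cellMean_le_rpow hN hk' _ h0 h1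
          · exact hdisc j l hj k
      _ = c j * |(k : ℝ)| ^ (-γ) := by
          rw [← htL, hcdef]
          push_cast
          rw [mul_pow, div_pow, pow_succ]
          field_simp
  have hmain := norm_le_add_sum_of_norm_sub_le (a := fun j => treeTransform N t (s j) j k)
    (fun j => mul_nonneg (hc0 j) hkγ) hlj hinc
  refine hmain.trans ?_
  rw [decayConst, add_mul, ← sum_mul]
  gcongr
  · exact (norm_treeTransform_le ht (hcard l) k).trans (norm_cellMean_le_rpow hN hk' l h0 h1)
  · exact hcs.sum_le_tsum _ fun j _ => hc0 j

theorem rpow_half_lt {N₀ t₀ n₀ : ℕ} (ht₀ : 1 < t₀) (htN : t₀ < N₀) (hn₀ : 0 < n₀) {β : ℝ}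
    (hβ : β < Real.log t₀ / Real.log N₀) :
    ((N₀ ^ (2 * n₀) : ℕ) : ℝ) ^ (β / 2) < ((t₀ ^ n₀ : ℕ) : ℝ) := by
  have hN₀ : (1 : ℝ) < N₀ := by exact_mod_cast ht₀.trans htN
  have ht₀' : (0 : ℝ) < t₀ := by exact_mod_cast (by omega : 0 < t₀)
  have hlog : 0 < Real.log N₀ := Real.log_pos hN₀
  have hn : (0 : ℝ) < n₀ := by exact_mod_cast hn₀
  rw [lt_div_iff₀ hlog] at hβ
  push_cast
  rw [← Real.log_lt_log_iff (by positivity) (by positivity), Real.log_rpow (by positivity),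
    Real.log_pow, Real.log_pow]
  push_cast
  nlinarith

end SalemCantor

/-! ### Assembly -/

theorem proposition2p2 (N₀ t₀ : ℕ) (ht₀ : 1 < t₀) (htN : t₀ < N₀) :
    ∃ m : ℕ, ∀ n₀ : ℕ, m ≤ n₀ →
      ∃ (C₁ : ℝ → ℝ) (C₂ : ℝ → ℕ → ℝ),
        ∀ P : Finset ℕ, SalemCantor.IsArithProg P (t₀ ^ n₀) →
          P ⊆ Finset.range (N₀ ^ (2 * n₀)) →
          ∃ D : ℕ → ℝ → Finset ℝ,
            SalemCantor.IsAdmissible (N₀ ^ (2 * n₀)) (t₀ ^ (2 * n₀)) D ∧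
            (∀ j : ℕ,
              SalemCantor.structured (N₀ ^ (2 * n₀)) P j ⊆ SalemCantor.endpoints D j ∧
              SalemCantor.structuredLevel (N₀ ^ (2 * n₀)) P j ⊆
                SalemCantor.level (N₀ ^ (2 * n₀)) D j) ∧
            ∃ μ : Measure ℝ, IsProbabilityMeasure μ ∧
              SalemCantor.IsWeakLimit
                (SalemCantor.levelMeasure (N₀ ^ (2 * n₀)) (t₀ ^ (2 * n₀)) D) μ ∧
              μ (SalemCantor.cantorSet (N₀ ^ (2 * n₀)) D)ᶜ = 0 ∧
              ∀ β : ℝ, 0 < β → β < Real.log t₀ / Real.log N₀ →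
                (∀ k : ℤ, k ≠ 0 →
                  ‖SalemCantor.fourierMeasure μ k‖ ≤ C₁ β * |(k : ℝ)| ^ (-(β / 2))) ∧
                (∀ l j : ℕ, l ≤ j → ∀ k : ℤ, k ≠ 0 →
                  ‖SalemCantor.fourierWeighted (SalemCantor.charFn (N₀ ^ (2 * n₀)) P l)
                      (SalemCantor.levelMeasure (N₀ ^ (2 * n₀)) (t₀ ^ (2 * n₀)) D j) k‖ ≤
                    C₂ β l * |(k : ℝ)| ^ (-(β / 2))) := by
  -- Any `n₀ ≥ 1` suffices; it ensures `N > 1` and a strict ratio. The constant for `μ` is the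
  -- weighted one at `l = 0`.
  refine ⟨1, fun n₀ hn₀ => ⟨fun β => SalemCantor.decayConst (N₀ ^ (2 * n₀)) (t₀ ^ n₀) (β / 2) 0,
    fun β l => SalemCantor.decayConst (N₀ ^ (2 * n₀)) (t₀ ^ n₀) (β / 2) l,
    fun P hP hPN => ?_⟩⟩
  have hlt := fun β => SalemCantor.rpow_half_lt ht₀ htN hn₀ (β := β)
  have hN1 : 1 < N₀ ^ (2 * n₀) := Nat.one_lt_pow (by omega) (by omega)
  have htN' : t₀ ^ (2 * n₀) ≤ N₀ ^ (2 * n₀) := Nat.pow_le_pow_left htN.le _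
  have hL : 0 < t₀ ^ n₀ := pow_pos (by omega) _
  have htL : t₀ ^ n₀ * t₀ ^ n₀ = t₀ ^ (2 * n₀) := by rw [← pow_add, two_mul]
  generalize N₀ ^ (2 * n₀) = N at *
  generalize t₀ ^ (2 * n₀) = t at *
  generalize t₀ ^ n₀ = L at *
  have hN : 0 < N := by omega
  have ht : 0 < t := htL ▸ Nat.mul_pos hL hL
  -- From here on the progression enters only through its cardinality.
  have hPc : P.card = L := by
    obtain ⟨x, d, hd, rfl⟩ := hP
    rw [Finset.card_image_of_injective _ (fun i i' h => Nat.eq_of_mul_eq_mul_right hd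
      (Nat.add_left_cancel h)), Finset.card_range]
  obtain ⟨B, hB, hBt, hPB, hdisc⟩ := SalemCantor.exists_digitTree hN hL htL htN' hPN hPc
  obtain ⟨μ, hμ, hweak, hsupp, hlim⟩ := SalemCantor.exists_weakLimit hN1 ht hB hBt
  have hsub : ∀ j, SalemCantor.structured N P j ⊆
      SalemCantor.endpoints (SalemCantor.digitChoice N B) j := fun j => by
    rw [SalemCantor.structured_eq hN, SalemCantor.endpoints_digitChoice hN]
    exact Finset.image_subset_image (SalemCantor.digitTree_mono hPB j)
  refine ⟨SalemCantor.digitChoice N B, SalemCantor.isAdmissible_digitChoice hN hB hBt,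
    fun j => ⟨hsub j, Set.biUnion_mono (hsub j) fun _ _ => Set.Ico_subset_Icc_self⟩,
    μ, hμ, hweak, hsupp, fun β hβ0 hβ => ?_⟩
  have hβ1 : β / 2 ≤ 1 := by
    have h1 : (1 : ℝ) < N₀ := by exact_mod_cast ht₀.trans htN
    have h2 : Real.log t₀ / Real.log N₀ ≤ 1 := by
      rw [div_le_one (Real.log_pos h1)]
      exact Real.log_le_log (by exact_mod_cast (by omega : 0 < t₀)) (by exact_mod_cast htN.le)
    linarith
  have key := fun l j (hlj : l ≤ j) (k : ℤ) (hk : k ≠ 0) =>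
    SalemCantor.norm_treeTransform_filter_le hN hL htL hB hBt hdisc (half_pos hβ0).le hβ1
      (hlt β hβ) hlj hk
  refine ⟨fun k hk => ?_, fun l j hlj k hk => ?_⟩
  · refine le_of_tendsto (hlim k).norm (Eventually.of_forall fun j => ?_)
    have h := key 0 j j.zero_le k hk
    -- At `l = 0` every node descends from the root, so the restriction is vacuous.
    rwa [Finset.filter_true_of_mem fun m hm => by
      simp [SalemCantor.digitTree, Nat.div_eq_of_lt (SalemCantor.digitTree_lt hB j m hm)]] at h
  · rw [SalemCantor.fourierWeighted_levelMeasure hN P hlj]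
    exact key l j hlj k hk
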